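/- Let $\delta=\log\bigl(\tfrac23\cdot 2^{2/3}\bigr)=0.05663\ldots$ (natural logarithm; that is, $0.05663\le\delta<0.05664$). A *tricolored sum-free set* in an abelian group $H$ is a set $M\subseteq S\times T\times U$, for some $S,T,U\subseteq H$, such that each of the three coordinate projections $M\to S$, $M\to T$, $M\to U$ is a bijection, $s+t+u=0$ for all $(s,t,u)\in M$, and $s+t+u\neq 0$ for all $(s,t,u)\in (S\times T\times U)\setminus M$; its size is $|M|$. **Theorem.** If $q$ is a prime power, $n\ge 0$ is an integer and $H\cong(\mathbb Z/q\mathbb Z)^n$, then every tricolored sum-free set $M$ in $H$ satisfies $$|M|\le 3\cdot|H|^{\,1-\delta/\log q}.$$ -/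

import Mathlib

namespace TricoloredSumFree

/-- `M` is a 3-dimensional perfect matching on `S × T × U`: a subset of `S × T × U` each of whose
three coordinate projections is a bijection onto the corresponding factor. -/
def IsPerfectMatching {H : Type*} (S T U : Set H) (M : Set (H × H × H)) : Prop :=
  M ⊆ S ×ˢ T ×ˢ U ∧
    Set.BijOn (fun p => p.1) M S ∧
    Set.BijOn (fun p => p.2.1) M T ∧
    Set.BijOn (fun p => p.2.2) M U

/-- `M` is a tricolored sum-free set in the abelian group `H`: a perfect matching on some
`S × T × U` which consists of exactly those triples of `S × T × U` that sum to zero. -/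
def IsTricoloredSumFree {H : Type*} [AddCommGroup H] (M : Set (H × H × H)) : Prop :=
  ∃ S T U : Set H, IsPerfectMatching S T U M ∧
    (∀ s t u : H, (s, t, u) ∈ M → s + t + u = 0) ∧
    (∀ s t u : H, (s, t, u) ∈ (S ×ˢ T ×ˢ U) \ M → s + t + u ≠ 0)

/-- The absolute constant `δ = log ((2/3) · 2^(2/3))`. -/
noncomputable def delta : ℝ := Real.log ((2 / 3 : ℝ) * (2 : ℝ) ^ (2 / 3 : ℝ))

end TricoloredSumFree

namespace TricoloredSumFree

/-! This is the slice rank method. Write `q = p ^ k`. Over `ZMod p`, the indicator of `x + y + z =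
0`, evaluated at the first, second and third coordinates of three members of `M`, is the identity
tensor on `M`, whose slice rank is `|M|`. By `sum_choose_eq_ite_add_eq_zero`, this indicator expands
in products of binomial coefficients with exponents satisfying `a i + b i + c i < q` in each
coordinate. The total degree is thus at most `n * (q - 1)`, and one of the three exponent vectors
has degree at most a third of that. So `|M|` is at most three times the number of such vectors,
which an exponential moment bounds by `(q * exp (-δ)) ^ n`. -/

/-- Take `h` of maximal support. Were the support smaller than the dimension, some nonzero `w ∈ W`
would vanish on it, and `h + w` would have larger support. -/
theorem exists_mem_finrank_le_card_support {K I : Type*} [Field K] [Fintype I] [DecidableEq K]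
    (W : Submodule K (I → K)) :
    ∃ h ∈ W, Module.finrank K W ≤ (Finset.univ.filter fun i => h i ≠ 0).card := by
  classical
  obtain ⟨S, ⟨h, hW, rfl⟩, hmax⟩ := Set.exists_max_image
    ((fun h : I → K => Finset.univ.filter fun i => h i ≠ 0) '' (W : Set (I → K)))
    Finset.card (Set.toFinite _) ⟨_, 0, W.zero_mem, rfl⟩
  refine ⟨h, hW, ?_⟩
  by_contra! hlt
  set S := Finset.univ.filter fun i => h i ≠ 0 with hS
  let r : W →ₗ[K] (S → K) := (LinearMap.funLeft K K (Subtype.val : S → I)).comp W.subtype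
  have hker : r.ker ≠ ⊥ := LinearMap.ker_ne_bot_of_finrank_lt (by simpa using hlt)
  obtain ⟨w, hw, hw0⟩ := Submodule.exists_mem_ne_zero_of_ne_bot hker
  have hwS : ∀ i ∈ S, (w : I → K) i = 0 := fun i hi => congrFun hw ⟨i, hi⟩
  obtain ⟨j, hj⟩ : ∃ j, (w : I → K) j ≠ 0 := by
    by_contra! hall
    exact hw0 (Subtype.ext (funext hall))
  have hjS : j ∉ S := fun hjS => hj (hwS j hjS)
  refine absurd (hmax _ ⟨h + w, W.add_mem hW w.2, rfl⟩) (not_le.2 (Finset.card_lt_card ?_))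
  refine (Finset.ssubset_iff_of_subset fun i hi => ?_).2 ⟨j, ?_, hjS⟩
  · simpa [hwS i hi] using hi
  · have : h j = 0 := by simpa [hS] using hjS
    simpa [this] using hj

/-- Contracting the third index with a `w` orthogonal to every `h c` kills the third sum. What
remains is a diagonal matrix of rank at most `|A| + |B|`, and `w` can be chosen with at least `|I| -
|C|` nonzero entries. -/
theorem card_le_of_diagonal_eq_sum_slices {K I A B C : Type*} [Field K] [Fintype I]
    [DecidableEq I] [Fintype A] [Fintype B] [Fintype C]
    (f : A → I → K) (f' : A → I → I → K) (g : B → I → K) (g' : B → I → I → K)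
    (h : C → I → K) (h' : C → I → I → K)
    (hsum : ∀ i j k, (∑ a, f a i * f' a j k) + (∑ b, g b j * g' b i k) + (∑ c, h c k * h' c i j) =
      if i = j ∧ j = k then 1 else 0) :
    Fintype.card I ≤ Fintype.card A + Fintype.card B + Fintype.card C := by
  classical
  let L : (I → K) →ₗ[K] (C → K) := (Matrix.of h).mulVecLin
  obtain ⟨w, hw, hcard⟩ := exists_mem_finrank_le_card_support L.ker
  have hker : Fintype.card I ≤ Fintype.card C + Module.finrank K L.ker := by
    have h1 := L.finrank_range_add_finrank_ker
    have h2 := L.range.finrank_le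
    simp only [Module.finrank_fintype_fun_eq_card] at h1 h2
    omega
  have hwC : ∀ c, ∑ k, h c k * w k = 0 := fun c => congrFun hw c
  have hdiag : Matrix.diagonal w =
      (Matrix.of fun i a => f a i) * (Matrix.of fun a j => ∑ k, f' a j k * w k) +
      (Matrix.of fun i b => ∑ k, g' b i k * w k) * Matrix.of g := by
    ext i j
    have e : ∑ k, w k * ((∑ a, f a i * f' a j k) + (∑ b, g b j * g' b i k) +
        (∑ c, h c k * h' c i j)) = ∑ k, w k * if i = j ∧ j = k then 1 else 0 :=
      Finset.sum_congr rfl fun k _ => by rw [hsum]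
    have e3 : ∑ k, w k * ∑ c, h c k * h' c i j = 0 := by
      simp_rw [Finset.mul_sum]
      rw [Finset.sum_comm]
      refine Finset.sum_eq_zero fun c _ => ?_
      rw [← zero_mul (h' c i j), ← hwC c, Finset.sum_mul]
      exact Finset.sum_congr rfl fun k _ => by ring
    simp only [mul_add, Finset.sum_add_distrib, e3, add_zero] at e
    simp only [Matrix.add_apply, Matrix.mul_apply, Matrix.of_apply, Matrix.diagonal_apply]
    have e4 : (∑ k, w k * if i = j ∧ j = k then 1 else 0) = if i = j then w i else 0 := by
      by_cases hij : i = j <;> simp [hij]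
    rw [← e4, ← e]
    simp_rw [Finset.mul_sum, Finset.sum_mul]
    congr 1
    · rw [Finset.sum_comm]
      exact Finset.sum_congr rfl fun a _ => Finset.sum_congr rfl fun k _ => by ring
    · rw [Finset.sum_comm]
      exact Finset.sum_congr rfl fun a _ => Finset.sum_congr rfl fun k _ => by ring
  have hrank : (Matrix.diagonal w).rank ≤ Fintype.card A + Fintype.card B := by
    rw [hdiag, ← Matrix.fromCols_mul_fromRows, ← Fintype.card_sum]
    exact (Matrix.rank_mul_le_left _ _).trans (Matrix.rank_le_card_width _)
  rw [Matrix.rank_diagonal, Fintype.card_subtype] at hrank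
  omega

/-- Each nonzero term is charged to the first of `a`, `b`, `c` that lies in `V`; the nested
conditionals prevent double counting. -/
theorem card_le_three_mul_of_diagonal_eq_sum {K I A : Type*} [Field K] [Fintype I]
    [DecidableEq I] [Fintype A] (V : Finset A) (κ : A → A → A → K)
    (hκ : ∀ a b c, a ∉ V → b ∉ V → c ∉ V → κ a b c = 0) (f g h : A → I → K)
    (hsum : ∀ i j k, ∑ a, ∑ b, ∑ c, κ a b c * (f a i * g b j * h c k) =
      if i = j ∧ j = k then 1 else 0) :
    Fintype.card I ≤ 3 * V.card := by
  classical
  have key := card_le_of_diagonal_eq_sum_slices (A := V) (B := V) (C := V)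
    (fun a i => f a i) (fun a j k => ∑ b, ∑ c, κ a b c * (g b j * h c k))
    (fun b j => g b j) (fun b i k => ∑ a, if a ∈ V then 0 else ∑ c, κ a b c * (f a i * h c k))
    (fun c k => h c k)
    (fun c i j => ∑ a, if a ∈ V then 0 else ∑ b, if b ∈ V then 0 else κ a b c * (f a i * g b j))
    (fun i j k => by
      rw [← hsum]
      have conv (F : A → K) : ∑ a : V, F a = ∑ a, if a ∈ V then F a else 0 := by
        rw [Finset.sum_coe_sort V F, Finset.sum_ite_mem, Finset.univ_inter]
      rw [conv fun a => f a i * ∑ b, ∑ c, κ a b c * (g b j * h c k),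
        conv fun b => g b j * ∑ a, if a ∈ V then 0 else ∑ c, κ a b c * (f a i * h c k),
        conv fun c => h c k * ∑ a, if a ∈ V then 0 else ∑ b, if b ∈ V then 0 else
          κ a b c * (f a i * g b j)]
      have e1 : (∑ a, if a ∈ V then f a i * ∑ b, ∑ c, κ a b c * (g b j * h c k) else 0) =
          ∑ a, ∑ b, ∑ c, if a ∈ V then κ a b c * (f a i * g b j * h c k) else 0 := by
        refine Finset.sum_congr rfl fun a _ => ?_
        split_ifs
        · simp_rw [Finset.mul_sum]
          exact Finset.sum_congr rfl fun b _ => Finset.sum_congr rfl fun c _ => by ring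
        · simp
      have e2 : (∑ b, if b ∈ V then g b j * ∑ a, (if a ∈ V then 0 else
            ∑ c, κ a b c * (f a i * h c k)) else 0) =
          ∑ a, ∑ b, ∑ c, if a ∉ V ∧ b ∈ V then κ a b c * (f a i * g b j * h c k) else 0 := by
        rw [Finset.sum_comm]
        refine Finset.sum_congr rfl fun b _ => ?_
        by_cases hb : b ∈ V
        · simp only [hb, if_true, and_true, Finset.mul_sum]
          refine Finset.sum_congr rfl fun a _ => ?_
          by_cases ha : a ∈ V
          · simp [ha]
          · simp only [ha, if_false, not_false_iff, if_true, Finset.mul_sum]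
            exact Finset.sum_congr rfl fun c _ => by ring
        · simp [hb]
      have e3 : (∑ c, if c ∈ V then h c k * ∑ a, (if a ∈ V then 0 else ∑ b, if b ∈ V then 0 else
          κ a b c * (f a i * g b j)) else 0) =
          ∑ a, ∑ b, ∑ c, if a ∉ V ∧ b ∉ V ∧ c ∈ V then κ a b c * (f a i * g b j * h c k)
            else 0 := by
        refine Eq.trans ?_
          (Finset.sum_comm.trans (Finset.sum_congr rfl fun a _ => Finset.sum_comm))
        refine Finset.sum_congr rfl fun c _ => ?_
        by_cases hc : c ∈ V
        · simp only [hc, if_true, and_true, Finset.mul_sum]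
          refine Finset.sum_congr rfl fun a _ => ?_
          by_cases ha : a ∈ V
          · simp [ha]
          · simp only [ha, if_false, not_false_iff, true_and, Finset.mul_sum]
            refine Finset.sum_congr rfl fun b _ => ?_
            by_cases hb : b ∈ V
            · simp [hb]
            · simp only [hb, if_false, not_false_iff, if_true]
              ring
        · simp [hc]
      rw [e1, e2, e3]
      simp_rw [← Finset.sum_add_distrib]
      refine Finset.sum_congr rfl fun a _ => Finset.sum_congr rfl fun b _ =>
        Finset.sum_congr rfl fun c _ => ?_
      by_cases ha : a ∈ V <;> by_cases hb : b ∈ V <;> by_cases hc : c ∈ V <;>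
        simp [ha, hb, hc, hκ])
  simp only [Fintype.card_coe] at key
  omega

/-! ### Binomial expansion of the zero-sum indicator modulo a prime power -/

theorem choose_add_prime_pow_cast_zmod {p k : ℕ} [Fact p.Prime] (m : ℕ) {j : ℕ} (hj : j < p ^ k) :
    ((m + p ^ k).choose j : ZMod p) = m.choose j := by
  rw [← Polynomial.coeff_one_add_X_pow, ← Polynomial.coeff_one_add_X_pow, pow_add,
    add_pow_char_pow, one_pow, mul_add, mul_one, Polynomial.coeff_add,
    Polynomial.coeff_mul_X_pow', if_neg (by omega), add_zero]

/-- By periodicity one may assume `m < p ^ k`, where the sum is the full expansion of `(1 - 1) ^ m`.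
-/
theorem sum_range_prime_pow_alternating_choose {p k : ℕ} [Fact p.Prime] (m : ℕ) :
    ∑ j ∈ Finset.range (p ^ k), (-1 : ZMod p) ^ j * (m.choose j : ZMod p) =
      if p ^ k ∣ m then 1 else 0 := by
  have hq : 0 < p ^ k := pow_pos (Fact.out : p.Prime).pos k
  induction m using Nat.strong_induction_on with
  | _ m ih =>
    by_cases hm : m < p ^ k
    · have h : ∑ j ∈ Finset.range (p ^ k), (-1 : ZMod p) ^ j * (m.choose j : ZMod p) =
          ∑ j ∈ Finset.range (m + 1), (-1 : ZMod p) ^ j * (m.choose j : ZMod p) := by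
        symm
        refine Finset.sum_subset (fun j hj => ?_) fun j _ hj => ?_
        · simp only [Finset.mem_range] at *; omega
        · rw [Nat.choose_eq_zero_of_lt (by simpa using hj)]; simp
      have h2 := congrArg (Int.cast : ℤ → ZMod p) (Int.alternating_sum_range_choose (n := m))
      push_cast at h2
      rw [h, h2]
      have : p ^ k ∣ m ↔ m = 0 := ⟨fun hd => Nat.eq_zero_of_dvd_of_lt hd hm, fun h => h ▸ dvd_zero _⟩
      simp [this]
    · obtain ⟨l, rfl⟩ := Nat.exists_eq_add_of_le' (not_lt.1 hm)
      rw [Finset.sum_congr rfl fun j hj => by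
        rw [choose_add_prime_pow_cast_zmod l (Finset.mem_range.1 hj)], ih l (by omega)]
      simp

/-- Vandermonde's identity; `hκ` discards the part of the square where `a + b ≥ q`. -/
theorem sum_range_mul_choose_mul_choose {R : Type*} [CommSemiring R] {q : ℕ} (κ : ℕ → R)
    (hκ : ∀ s, q ≤ s → κ s = 0) (x y : ℕ) :
    ∑ a ∈ Finset.range q, ∑ b ∈ Finset.range q, κ (a + b) * (x.choose a * y.choose b) =
      ∑ s ∈ Finset.range q, κ s * ((x + y).choose s : R) := by
  simp_rw [Nat.add_choose_eq, Nat.cast_sum, Finset.mul_sum]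
  rw [← Finset.sum_product', Finset.sum_sigma']
  refine (Finset.sum_of_injOn (fun s => s.2) ?_ ?_ ?_ ?_).symm
  · rintro ⟨s, a, b⟩ hs ⟨s', a', b'⟩ hs' h
    simp_all
  · rintro ⟨s, a, b⟩ hs
    simp_all
    omega
  · rintro ⟨a, b⟩ h1 h2
    rw [hκ, zero_mul]
    by_contra! h
    exact h2 ⟨⟨a + b, a, b⟩, by simpa using h, rfl⟩
  · rintro ⟨s, a, b⟩ hs
    simp_all

theorem sum_choose_eq_ite_add_eq_zero {p k q : ℕ} [Fact p.Prime] [NeZero q] (hq : q = p ^ k)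
    (x y z : ZMod q) :
    ∑ a : Fin q, ∑ b : Fin q, ∑ c : Fin q,
      (if (a + b + c : ℕ) < q then (-1 : ZMod p) ^ (a + b + c : ℕ) else 0) *
        (x.val.choose a * y.val.choose b * z.val.choose c) =
      if x + y + z = 0 then 1 else 0 := by
  let κ : ℕ → ZMod p := fun s => if s < q then (-1) ^ s else 0
  have hdvd : x + y + z = 0 ↔ q ∣ x.val + y.val + z.val := by
    rw [← ZMod.natCast_eq_zero_iff]
    simp
  have halt := sum_range_prime_pow_alternating_choose (p := p) (k := k) (x.val + y.val + z.val)
  rw [← hq] at halt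
  rw [if_congr hdvd rfl rfl, ← halt]
  have h1 := sum_range_mul_choose_mul_choose (q := q) κ (fun s hs => by simp [κ, hs])
    (x.val + y.val) z.val
  have h2 : ∀ c, ∑ a ∈ Finset.range q, ∑ b ∈ Finset.range q,
      κ (a + b + c) * (x.val.choose a * y.val.choose b) =
        ∑ s ∈ Finset.range q, κ (s + c) * ((x.val + y.val).choose s : ZMod p) := fun c =>
    sum_range_mul_choose_mul_choose (q := q) (fun s => κ (s + c))
      (fun s hs => by simp only [κ]; rw [if_neg (by omega)]) _ _
  have h3 : ∑ s ∈ Finset.range q, κ s * ((x.val + y.val + z.val).choose s : ZMod p) =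
      ∑ j ∈ Finset.range q, (-1 : ZMod p) ^ j * ((x.val + y.val + z.val).choose j : ZMod p) :=
    Finset.sum_congr rfl fun s hs => by simp [κ, Finset.mem_range.1 hs]
  have h4 : ∀ c, ∑ a ∈ Finset.range q, κ (a + c) *
      ((x.val + y.val).choose a * (z.val.choose c : ZMod p)) =
      ∑ a ∈ Finset.range q, ∑ b ∈ Finset.range q,
        κ (a + b + c) * (x.val.choose a * y.val.choose b * z.val.choose c) := fun c => by
    simp_rw [← mul_assoc]
    rw [← Finset.sum_mul, ← h2 c]
    simp_rw [Finset.sum_mul, ← mul_assoc]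
  rw [← h3, ← h1, Finset.sum_comm (s := Finset.range q), Finset.sum_congr rfl fun c _ => h4 c]
  simp only [Finset.sum_range]
  refine Eq.trans ?_ Finset.sum_comm
  exact Finset.sum_congr rfl fun a _ => Finset.sum_comm

/-! ### Numerical bounds and the count of low-degree exponents -/

theorem delta_eq : delta = Real.log (32 / 27) / 3 := by
  rw [delta, eq_div_iff three_ne_zero, mul_comm, ← Nat.cast_three, ← Real.log_pow, mul_pow,
    ← Real.rpow_mul_natCast two_pos.le]
  norm_num

theorem delta_bounds : 0.05663 ≤ Real.log (32 / 27) / 3 ∧ Real.log (32 / 27) / 3 < 0.05664 := by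
  have h := Real.exp_bound' (x := 0.16989) (by norm_num) (by norm_num) (n := 5) (by norm_num)
  have h' := Real.sum_le_exp_of_nonneg (x := 0.16992) (by norm_num) 5
  norm_num [Finset.sum_range_succ, Nat.factorial] at h h'
  constructor
  · rw [le_div_iff₀ (by norm_num), Real.le_log_iff_exp_le (by norm_num)]
    norm_num
    linarith
  · rw [div_lt_iff₀ (by norm_num), Real.log_lt_iff_lt_exp (by norm_num)]
    norm_num
    linarith

/-- Exponential-moment bound for the number of exponent vectors of small total degree. -/
theorem card_filter_sum_le_mul_pow (n q : ℕ) {x : ℝ} (hx0 : 0 < x) (hx1 : x ≤ 1) :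
    ((Finset.univ.filter fun v : Fin n → Fin q => 3 * ∑ i, (v i : ℕ) ≤ n * (q - 1)).card : ℝ) *
      (x ^ (((q - 1 : ℕ) : ℝ) / 3)) ^ n ≤ (∑ j : Fin q, x ^ (j : ℕ)) ^ n := by
  have h : (∑ j : Fin q, x ^ (j : ℕ)) ^ n = ∑ v : Fin n → Fin q, x ^ ∑ i, (v i : ℕ) := by
    simp_rw [← Finset.prod_pow_eq_pow_sum]
    rw [← Fintype.piFinset_univ, ← Finset.prod_univ_sum (fun _ => Finset.univ)
      fun _ (j : Fin q) => x ^ (j : ℕ)]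
    simp
  rw [h, ← nsmul_eq_mul, ← Finset.sum_const]
  refine (Finset.sum_le_sum fun v hv => ?_).trans
    (Finset.sum_le_sum_of_subset_of_nonneg (Finset.filter_subset _ _) fun v _ _ => by positivity)
  rw [← Real.rpow_mul_natCast hx0.le, ← Real.rpow_natCast]
  refine Real.rpow_le_rpow_of_exponent_ge hx0 hx1 ?_
  have := (Finset.mem_filter.1 hv).2
  have h' : (3 * ((∑ i, (v i : ℕ) : ℕ) : ℝ)) ≤ n * (q - 1 : ℕ) := by exact_mod_cast this
  linarith

theorem exists_geom_sum_le_mul_rpow {q : ℕ} (hq : 2 ≤ q) :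
    ∃ x : ℝ, 0 < x ∧ x ≤ 1 ∧ ∑ j : Fin q, x ^ (j : ℕ) ≤
      q * Real.exp (-(Real.log (32 / 27) / 3)) * x ^ (((q - 1 : ℕ) : ℝ) / 3) := by
  obtain rfl | hq := hq.eq_or_lt
  -- For `q = 2` equality holds at `x = 1 / 2`; this case dictates the value of `δ`.
  · refine ⟨1 / 2, by norm_num, by norm_num, ?_⟩
    have h : Real.exp (-(Real.log (32 / 27) / 3)) * (1 / 2 : ℝ) ^ (((2 - 1 : ℕ) : ℝ) / 3) =
        3 / 4 := by
      rw [Real.rpow_def_of_pos (by norm_num), ← Real.exp_add, ← Real.exp_log (x := 3 / 4)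
        (by norm_num)]
      congr 1
      have : Real.log (3 / 4) = Real.log ((1 / 2) / (32 / 27)) / 3 := by
        rw [eq_div_iff three_ne_zero, mul_comm, ← Nat.cast_three, ← Real.log_pow]
        norm_num
      rw [this, Real.log_div (x := 1 / 2) (by norm_num) (by norm_num)]
      push_cast
      ring
    rw [mul_assoc, h]
    norm_num [Fin.sum_univ_succ]
  · have hq' : (3 : ℝ) ≤ q := by exact_mod_cast hq
    have hq0 : (0 : ℝ) < q := by linarith
    set s : ℝ := 1 / q with hs
    have hs0 : 0 < s := by positivity
    have hqs : q * s = 1 := by rw [hs]; field_simp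
    have hs3 : s ≤ 1 / 3 := by rw [hs]; gcongr
    -- With `x = exp (-2 / q)` and `sinh s ≥ s`, the claim reduces to `1 - exp (-2) ≤ 2 * exp (-δ -
    -- 2 / 3 - s / 3)`.
    refine ⟨Real.exp (-2 * s), Real.exp_pos _, Real.exp_le_one_iff.2 (by linarith), ?_⟩
    have hx1 : Real.exp (-2 * s) < 1 := Real.exp_lt_one_iff.2 (by linarith)
    rw [Fin.sum_univ_eq_sum_range (fun j => Real.exp (-2 * s) ^ j), geom_sum_eq hx1.ne,
      ← Real.exp_nat_mul, ← Real.exp_mul, ← neg_div_neg_eq, neg_sub, neg_sub,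
      div_le_iff₀ (by linarith)]
    have hsinh : 2 * s * Real.exp (-s) ≤ 1 - Real.exp (-2 * s) := by
      have h1 := Real.self_le_sinh_iff.2 hs0.le
      rw [Real.sinh_eq] at h1
      have h2 : Real.exp (-2 * s) = Real.exp (-s) * Real.exp (-s) := by
        rw [← Real.exp_add]; ring_nf
      have h3 : Real.exp s * Real.exp (-s) = 1 := by rw [← Real.exp_add]; simp
      nlinarith [Real.exp_pos (-s)]
    have hpos : 0 ≤ q * Real.exp (-(Real.log (32 / 27) / 3)) *
        Real.exp (-2 * s * (((q - 1 : ℕ) : ℝ) / 3)) := by positivity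
    refine le_trans ?_ (mul_le_mul_of_nonneg_left hsinh hpos)
    have hcast : ((q - 1 : ℕ) : ℝ) = q - 1 := by rw [Nat.cast_sub (by omega)]; simp
    have e1 : (q : ℝ) * (-2 * s) = -2 := by linarith
    have e2 : -2 * s * (((q : ℝ) - 1) / 3) = -2 / 3 + 2 / 3 * s := by linear_combination (-2/3) * hqs
    rw [hcast, e1, e2]
    have e3 : q * Real.exp (-(Real.log (32 / 27) / 3)) * Real.exp (-2 / 3 + 2 / 3 * s) *
        (2 * s * Real.exp (-s)) =
        2 * Real.exp (-(Real.log (32 / 27) / 3) + (-2 / 3 + 2 / 3 * s) + -s) := by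
      rw [Real.exp_add _ (-s), Real.exp_add _ (-2 / 3 + 2 / 3 * s)]
      linear_combination (2 * Real.exp (-(Real.log (32 / 27) / 3)) *
        Real.exp (-2 / 3 + 2 / 3 * s) * Real.exp (-s)) * hqs
    rw [e3]
    -- The worst case is `s = 1 / 3`, and `0.05664 + 2 / 3 + 1 / 9 < 0.83442`. The next two bounds
    -- match because `1 - 0.132 = 2 * 0.434`.
    have h4 : Real.exp (-0.83442) ≤
        Real.exp (-(Real.log (32 / 27) / 3) + (-2 / 3 + 2 / 3 * s) + -s) := by
      refine Real.exp_le_exp.2 ?_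
      have := delta_bounds.2
      linarith
    have h5 : 0.434 ≤ Real.exp (-0.83442) := by
      have := Real.exp_bound' (x := 0.83442) (by norm_num) (by norm_num) (n := 6) (by norm_num)
      rw [Real.exp_neg, le_inv_comm₀ (by norm_num) (Real.exp_pos _)]
      refine this.trans ?_
      norm_num [Finset.sum_range_succ, Nat.factorial]
    have h6 : 0.132 ≤ Real.exp (-2) := by
      rw [Real.exp_neg, le_inv_comm₀ (by norm_num) (Real.exp_pos _)]
      have h := Real.exp_one_lt_d9
      have : Real.exp 2 = Real.exp 1 * Real.exp 1 := by rw [← Real.exp_add]; norm_num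
      rw [this]
      norm_num
      nlinarith [Real.exp_pos 1]
    linarith

/-! ### Slice rank bound for tricolored sum-free sets -/

theorem ncard_le_of_isTricoloredSumFree {p k q n : ℕ} [Fact p.Prime] [NeZero q]
    (hq : q = p ^ k) {H : Type*} [AddCommGroup H] (e : H ≃+ (Fin n → ZMod q))
    {M : Set (H × H × H)} (hM : TricoloredSumFree.IsTricoloredSumFree M) :
    M.ncard ≤ 3 * (Finset.univ.filter fun v : Fin n → Fin q =>
      3 * ∑ i, (v i : ℕ) ≤ n * (q - 1)).card := by
  classical
  obtain ⟨S, T, U, ⟨hsub, h1, h2, h3⟩, hzero, hne⟩ := hM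
  have : Finite H := Finite.of_equiv _ e.toEquiv.symm
  have : Fintype M := Fintype.ofFinite M
  rw [← Nat.card_coe_set_eq, Nat.card_eq_fintype_card]
  have hprod (F : Fin n → Fin q → ZMod p) : ∏ i, ∑ j, F i j =
      ∑ v : Fin n → Fin q, ∏ i, F i (v i) := by
    rw [Finset.prod_univ_sum, Fintype.piFinset_univ]
  have hprod₃ (F : Fin n → Fin q → Fin q → Fin q → ZMod p) : ∏ i, ∑ a, ∑ b, ∑ c, F i a b c =
      ∑ a : Fin n → Fin q, ∑ b : Fin n → Fin q, ∑ c : Fin n → Fin q,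
        ∏ i, F i (a i) (b i) (c i) := by
    simp_rw [hprod]
  let φ : (Fin n → Fin q) → H → ZMod p := fun v x => ∏ i, (((e x i).val.choose (v i) : ℕ) : ZMod p)
  refine card_le_three_mul_of_diagonal_eq_sum (K := ZMod p) _
    (fun a b c => ∏ i, if (a i + b i + c i : ℕ) < q then (-1) ^ (a i + b i + c i : ℕ) else 0)
    (fun a b c ha hb hc => ?_) (fun v m => φ v m.1.1) (fun v m => φ v m.1.2.1)
    (fun v m => φ v m.1.2.2) fun l m r => ?_
  · simp only [Finset.mem_filter, Finset.mem_univ, true_and, not_le] at ha hb hc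
    -- Three degrees each above `n * (q - 1) / 3` force some coordinate sum to reach `q`.
    obtain ⟨i, hi⟩ : ∃ i, q ≤ (a i + b i + c i : ℕ) := by
      by_contra! hlt
      have := Finset.sum_le_card_nsmul Finset.univ (fun i => (a i + b i + c i : ℕ)) (q - 1)
        fun i _ => Nat.le_sub_one_of_lt (hlt i)
      simp only [Finset.sum_add_distrib, Finset.card_univ, Fintype.card_fin, smul_eq_mul] at this
      omega
    exact Finset.prod_eq_zero (Finset.mem_univ i) (if_neg hi.not_gt)
  · simp only [φ, ← Finset.prod_mul_distrib]
    refine (hprod₃ fun i a b c => (if (a + b + c : ℕ) < q then (-1) ^ (a + b + c : ℕ) else 0) *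
      ((e l.1.1 i).val.choose a * (e m.1.2.1 i).val.choose b *
        (e r.1.2.2 i).val.choose c)).symm.trans ?_
    simp_rw [sum_choose_eq_ite_add_eq_zero hq]
    rw [Finset.prod_ite_zero, Finset.prod_const_one]
    have hsum : (∀ i ∈ Finset.univ, e l.1.1 i + e m.1.2.1 i + e r.1.2.2 i = 0) ↔
        l.1.1 + m.1.2.1 + r.1.2.2 = 0 := by
      rw [← e.map_eq_zero_iff, map_add, map_add, funext_iff]
      simp
    by_cases heq : l = m ∧ m = r
    · obtain ⟨rfl, rfl⟩ := heq
      rw [if_pos (hsum.2 (hzero _ _ _ l.2)), if_pos ⟨rfl, rfl⟩]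
    · refine (if_neg fun h => heq ?_).trans (if_neg heq).symm
      -- A mixed triple with zero sum must lie in `M`, and injectivity of the projections then
      -- identifies it with each of `l`, `m`, `r`.
      have hmem : (l.1.1, m.1.2.1, r.1.2.2) ∈ M := by
        by_contra hnot
        exact hne l.1.1 m.1.2.1 r.1.2.2 ⟨⟨(hsub l.2).1, (hsub m.2).2.1, (hsub r.2).2.2⟩, hnot⟩
          (hsum.1 h)
      have e1 := h1.injOn hmem l.2 rfl
      have e2 := h2.injOn hmem m.2 rfl
      have e3 := h3.injOn hmem r.2 rfl
      exact ⟨Subtype.ext (e1.symm.trans e2), Subtype.ext (e2.symm.trans e3)⟩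

end TricoloredSumFree

theorem mainTheorem2 :
    (0.05663 ≤ TricoloredSumFree.delta ∧ TricoloredSumFree.delta < 0.05664) ∧
    ∀ (q n : ℕ), IsPrimePow q →
      ∀ (H : Type*) [AddCommGroup H], Nonempty (H ≃+ (Fin n → ZMod q)) →
        ∀ M : Set (H × H × H), TricoloredSumFree.IsTricoloredSumFree M →
          (M.ncard : ℝ) ≤
            3 * (Nat.card H : ℝ) ^ (1 - TricoloredSumFree.delta / Real.log (q : ℝ)) := by
  rw [TricoloredSumFree.delta_eq]
  refine ⟨TricoloredSumFree.delta_bounds, ?_⟩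
  rintro q n hq H _ ⟨e⟩ M hM
  obtain ⟨p, k, hp, -, hpk⟩ := (isPrimePow_nat_iff q).1 hq
  have : Fact p.Prime := ⟨hp⟩
  have hq2 : 2 ≤ q := hq.two_le
  have : NeZero q := ⟨by omega⟩
  have hq0 : (0 : ℝ) < q := by positivity
  have hlog : Real.log q ≠ 0 := (Real.log_pos (by exact_mod_cast hq2)).ne'
  have hcard : (Nat.card H : ℝ) ^ (1 - Real.log (32 / 27) / 3 / Real.log (q : ℝ)) =
      (q * Real.exp (-(Real.log (32 / 27) / 3))) ^ n := by
    rw [Nat.card_congr e.toEquiv, Nat.card_fun, Nat.card_zmod, Nat.card_fin, Nat.cast_pow,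
      ← Real.rpow_natCast_mul hq0.le, mul_comm, Real.rpow_mul_natCast hq0.le,
      Real.rpow_def_of_pos hq0, mul_sub, mul_one, mul_div_cancel₀ _ hlog, sub_eq_add_neg,
      Real.exp_add, Real.exp_log hq0]
  rw [hcard]
  refine (Nat.cast_le.2 (TricoloredSumFree.ncard_le_of_isTricoloredSumFree hpk.symm e hM)).trans ?_
  obtain ⟨x, hx0, hx1, hx⟩ := TricoloredSumFree.exists_geom_sum_le_mul_rpow hq2
  have hmom := (TricoloredSumFree.card_filter_sum_le_mul_pow n q hx0 hx1).trans
    (pow_le_pow_left₀ (by positivity) hx n)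
  rw [mul_pow] at hmom
  push_cast
  gcongr
  exact le_of_mul_le_mul_right hmom (by positivity)
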